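/- Conventions. An effect algebra is a partial commutative monoid $(A,\oplus,0)$ with an operation $(-)^\perp\colon A\to A$ such that, writing $1=0^\perp$, $x^\perp$ is the unique $y$ with $x\oplus y=1$, and $x\oplus 1$ is defined if and only if $x=0$. Morphisms preserve $0$, $(-)^\perp$ and $\oplus$ (whenever $a\oplus b$ is defined, so is $f(a)\oplus f(b)$, and it equals $f(a\oplus b)$); this gives the category $\mathbf{EA}$. A Boolean algebra is an effect algebra with $a\oplus b=a\vee b$, defined iff $a\wedge b=0$, and $a^\perp=\neg a$; the interval $[0,1]$ is an effect algebra with $r\oplus s=r+s$, defined iff $r+s\le 1$, and $r^\perp=1-r$. A bilinear morphism $A\times B\to C$ is a map that preserves $0$ and $\oplus$ in each variable separately and sends $(1,1)$ to $1$; the tensor product $A\otimes B$ is the effect algebra representing bilinear morphisms out of $A\times B$. An effect module is an effect algebra $E$ with a bilinear morphism $[0,1]\times E\to E$, $(r,x)\mapsto rx$, such that $1x=x$ and $(rs)x=r(sx)$; effect modules and the effect algebra morphisms preserving the action form the category $\mathbf{EMod}$. The forgetful functor $\mathbf{EMod}\to\mathbf{EA}$ has the left adjoint $A\mapsto[0,1]\otimes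 A$ with unit $a\mapsto 1\otimes a$; let $\mathcal M$ be the induced monad on $\mathbf{EA}$, with $\mathcal M A=[0,1]\otimes A$. Let $\mathbf{Kl}_{\mathbf{BA}_{\mathsf f}}(\mathcal M)$ be the full subcategory of the Kleisli category of $\mathcal M$ on the finite Boolean algebras, and let $$I_{\mathcal M}\colon \mathbf{Kl}_{\mathbf{BA}_{\mathsf f}}(\mathcal M)\to\mathbf{EMod}$$ be the canonical functor sending $B$ to the effect module $[0,1]\otimes B$ and a Kleisli morphism $f\colon B\to[0,1]\otimes B'$ to its unique extension to an effect module morphism $[0,1]\otimes B\to[0,1]\otimes B'$. Proposition. The functor $I_{\mathcal M}$ is full and faithful; for every finite set $X$ there is an isomorphism of effect modules $I_{\mathcal M}(2^X)\cong[0,1]^X$ (with pointwise structure on $[0,1]^X$) sending $1\otimes S$ to the characteristic function $\chi_S$ for each $S\subseteq X$; and $I_{\mathcal M}$ is dense, that is, every effect module $E$ is the colimit of the canonical diagram of all morphisms $I_{\mathcal M}(B)\to E$, with $B$ in $\mathbf{Kl}_{\mathbf{BA}_{\mathsf f}}(\mathcal M)$, with these morphisms as colimit cocone. -/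

import Mathlib

open CategoryTheory

universe u v w

/-! ### Effect algebras -/

/-- An effect algebra: a partial commutative monoid `(A, ⊕, 0)`, where `⊕` is a partial binary
operation (the commutative and associative laws are Kleene equalities: one side is defined iff the
other one is, and then they agree), with an orthocomplement `(-)ᗮ` such that, for `1 := 0ᗮ`,
the element `xᗮ` is the unique `y` with `x ⊕ y = 1`, and `x ⊕ 1` is defined iff `x = 0`. -/
class EffectAlgebra (A : Type u) where
  zero : A
  oplus : A → A → Part A
  compl : A → A
  zero_oplus : ∀ a, oplus zero a = Part.some a
  oplus_comm : ∀ a b, oplus a b = oplus b a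
  oplus_assoc : ∀ a b c,
    ((oplus a b).bind fun d => oplus d c) = ((oplus b c).bind fun e => oplus a e)
  oplus_eq_one_iff : ∀ a b, oplus a b = Part.some (compl zero) ↔ b = compl a
  oplus_one_dom_iff : ∀ a, (oplus a (compl zero)).Dom ↔ a = zero

namespace EffectAlgebra

/-- The unit `1 = 0ᗮ`. -/
def one {A : Type u} [EffectAlgebra A] : A := compl zero

section lemmas

variable {A : Type u} [EffectAlgebra A] {B : Type v} [EffectAlgebra B]

theorem mem_comm {a b c : A} (h : c ∈ oplus a b) : c ∈ oplus b a := by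
  rwa [oplus_comm]

theorem mem_zero (a : A) : a ∈ oplus zero a := by
  rw [zero_oplus]; exact Part.mem_some a

theorem eq_of_mem_zero {a b : A} (h : b ∈ oplus zero a) : b = a :=
  Part.mem_unique h (mem_zero a)

theorem mem_assoc {a b c d e : A} (hd : d ∈ oplus a b) (he : e ∈ oplus d c) :
    ∃ f, f ∈ oplus b c ∧ e ∈ oplus a f := by
  have : e ∈ (oplus a b).bind fun d => oplus d c := Part.mem_bind_iff.2 ⟨d, hd, he⟩
  rw [oplus_assoc] at this
  exact Part.mem_bind_iff.1 this

theorem mem_assoc' {a b c e f : A} (hf : f ∈ oplus b c) (he : e ∈ oplus a f) :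
    ∃ d, d ∈ oplus a b ∧ e ∈ oplus d c := by
  have : e ∈ (oplus b c).bind fun f => oplus a f := Part.mem_bind_iff.2 ⟨f, hf, he⟩
  rw [← oplus_assoc] at this
  exact Part.mem_bind_iff.1 this

theorem one_mem_iff {a b : A} : one ∈ oplus a b ↔ b = compl a := by
  rw [← oplus_eq_one_iff, Part.eq_some_iff]; rfl

theorem one_mem (a : A) : one ∈ oplus a (compl a) := one_mem_iff.2 rfl

theorem cancel {a b b' c : A} (h : c ∈ oplus a b) (h' : c ∈ oplus a b') : b = b' := by
  obtain ⟨f, hf, hf1⟩ := mem_assoc (mem_comm h) (one_mem c)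
  obtain ⟨f', hf', hf1'⟩ := mem_assoc (mem_comm h') (one_mem c)
  obtain rfl := Part.mem_unique hf hf'
  rw [one_mem_iff.1 (mem_comm hf1), one_mem_iff.1 (mem_comm hf1')]

theorem eq_zero_of_mem_left {a c : A} (h : c ∈ oplus a c) : a = zero :=
  cancel (mem_comm h) (mem_comm (mem_zero c))

theorem eq_zero_of_mem_zero {a b : A} (h : zero ∈ oplus a b) : a = zero := by
  have hb : b = zero := by
    obtain ⟨f, hf, -⟩ := mem_assoc h (mem_zero (one : A))
    exact (oplus_one_dom_iff b).1 hf.1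
  subst hb
  exact (eq_of_mem_zero (mem_comm h)).symm

theorem mem_exchange {p₁ p₂ q₁ q₂ p q z z₁ z₂ : A} (hp : p ∈ oplus p₁ p₂) (hq : q ∈ oplus q₁ q₂)
    (h₁ : z₁ ∈ oplus p₁ q₁) (h₂ : z₂ ∈ oplus p₂ q₂) (hz : z ∈ oplus p q) :
    z ∈ oplus z₁ z₂ := by
  obtain ⟨s, hs, hzs⟩ := mem_assoc hp hz
  obtain ⟨t, ht, hst⟩ := mem_assoc' hq hs
  obtain ⟨t', ht', hst'⟩ := mem_assoc (mem_comm ht) hst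
  obtain rfl := Part.mem_unique ht' h₂
  obtain ⟨t'', h1', hz'⟩ := mem_assoc' hst' hzs
  obtain rfl := Part.mem_unique h1' h₁
  exact hz'

theorem dom_mono {p p' c q q' d : A} (hp : c ∈ oplus p p') (hq : d ∈ oplus q q')
    (h : (oplus c d).Dom) : (oplus p q).Dom := by
  obtain ⟨z, hz⟩ := Part.dom_iff_mem.1 h
  obtain ⟨s, hs, -⟩ := mem_assoc (mem_comm hp) hz
  obtain ⟨t, ht, -⟩ := mem_assoc' hq hs
  exact Part.dom_iff_mem.2 ⟨t, ht⟩

end lemmas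

/-- A morphism of effect algebras preserves `0`, the orthocomplement (hence also `1`), and `⊕`
(if `a ⊕ b` is defined and equal to `c`, then `f a ⊕ f b` is defined and equal to `f c`). -/
@[ext]
structure Hom (A : Type u) (B : Type v) [EffectAlgebra A] [EffectAlgebra B] where
  toFun : A → B
  map_zero : toFun zero = zero
  map_compl : ∀ a, toFun (compl a) = compl (toFun a)
  map_oplus : ∀ a b c, c ∈ oplus a b → toFun c ∈ oplus (toFun a) (toFun b)

theorem Hom.map_one {A : Type u} {B : Type v} [EffectAlgebra A] [EffectAlgebra B] (f : Hom A B) :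
    f.toFun one = one := by
  unfold one; rw [f.map_compl, f.map_zero]

/-- A bilinear morphism `A × B → C` of effect algebras: it is a morphism of partial commutative
monoids in each variable, and maps `(1, 1)` to `1`. -/
@[ext]
structure Bimorphism (A : Type u) (B : Type v) (C : Type w)
    [EffectAlgebra A] [EffectAlgebra B] [EffectAlgebra C] where
  toFun : A → B → C
  zero_left : ∀ b, toFun zero b = zero
  zero_right : ∀ a, toFun a zero = zero
  oplus_left : ∀ a a' a'' b, a'' ∈ oplus a a' →
    toFun a'' b ∈ oplus (toFun a b) (toFun a' b)
  oplus_right : ∀ a b b' b'', b'' ∈ oplus b b' →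
    toFun a b'' ∈ oplus (toFun a b) (toFun a b')
  one_one : toFun one one = one

/-- The partial binary operation with graph `R`. -/
noncomputable def relPart {A : Type u} (R : A → A → A → Prop) (a b : A) : Part A :=
  ⟨∃ c, R a b c, fun h => h.choose⟩

theorem mem_relPart {A : Type u} {R : A → A → A → Prop}
    (uniq : ∀ a b c c', R a b c → R a b c' → c = c') {a b c : A} :
    c ∈ relPart R a b ↔ R a b c := by
  constructor
  · rintro ⟨h, rfl⟩; exact h.choose_spec
  · intro h; exact ⟨⟨c, h⟩, uniq _ _ _ _ (Exists.choose_spec (⟨c, h⟩ : ∃ c, R a b c)) h⟩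

/-- An effect algebra presented by the graph `R a b c` of its partial operation, that is, by the
relation "`a ⊕ b` is defined and equal to `c`". -/
@[reducible] noncomputable def ofRel {A : Type u} (zero : A) (compl : A → A) (R : A → A → A → Prop)
    (uniq : ∀ a b c c', R a b c → R a b c' → c = c')
    (zero_add : ∀ a, R zero a a)
    (comm : ∀ a b c, R a b c → R b a c)
    (assoc : ∀ a b c d e, R a b d → R d c e → ∃ f, R b c f ∧ R a f e)
    (compl_iff : ∀ a b, R a b (compl zero) ↔ b = compl a)
    (one : ∀ a c, R a (compl zero) c → a = zero) : EffectAlgebra A where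
  zero := zero
  compl := compl
  oplus := relPart R
  zero_oplus a := by
    rw [Part.eq_some_iff, mem_relPart uniq]; exact zero_add a
  oplus_comm a b := by
    ext c; rw [mem_relPart uniq, mem_relPart uniq]; exact ⟨comm _ _ _, comm _ _ _⟩
  oplus_assoc a b c := by
    ext e
    simp only [Part.mem_bind_iff, mem_relPart uniq]
    constructor
    · rintro ⟨d, h1, h2⟩
      exact assoc _ _ _ _ _ h1 h2
    · rintro ⟨f, h1, h2⟩
      obtain ⟨d, h3, h4⟩ := assoc _ _ _ _ _ (comm _ _ _ h1) (comm _ _ _ h2)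
      exact ⟨d, comm _ _ _ h3, comm _ _ _ h4⟩
  oplus_eq_one_iff a b := by
    rw [Part.eq_some_iff, mem_relPart uniq]; exact compl_iff a b
  oplus_one_dom_iff a := by
    constructor
    · rintro ⟨c, h⟩; exact one a c h
    · rintro rfl; exact ⟨_, zero_add _⟩

/-- A Boolean algebra as an effect algebra: `a ⊕ b = a ⊔ b`, defined iff `a ⊓ b = ⊥`, and
`aᗮ = aᶜ`. -/
@[reducible] def ofBooleanAlgebra (B : Type u) [BooleanAlgebra B] : EffectAlgebra B where
  zero := ⊥
  oplus a b := ⟨a ⊓ b = ⊥, fun _ => a ⊔ b⟩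
  compl a := aᶜ
  zero_oplus a := by
    rw [Part.eq_some_iff]; exact ⟨bot_inf_eq a, bot_sup_eq a⟩
  oplus_comm a b := by
    refine Part.ext' ?_ ?_
    · simp [inf_comm]
    · intro _ _; exact sup_comm a b
  oplus_assoc a b c := by
    ext e
    simp only [Part.mem_bind_iff]
    constructor
    · rintro ⟨d, ⟨h1, rfl⟩, ⟨h2, rfl⟩⟩
      simp only [inf_sup_right, sup_eq_bot_iff] at h2
      exact ⟨b ⊔ c, ⟨h2.2, rfl⟩, ⟨by simp only [inf_sup_left, sup_eq_bot_iff]; exact ⟨h1, h2.1⟩,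
        (sup_assoc a b c).symm⟩⟩
    · rintro ⟨d, ⟨h1, rfl⟩, ⟨h2, rfl⟩⟩
      simp only [inf_sup_left, sup_eq_bot_iff] at h2
      exact ⟨a ⊔ b, ⟨h2.1, rfl⟩, ⟨by simp only [inf_sup_right, sup_eq_bot_iff]; exact ⟨h2.2, h1⟩,
        sup_assoc a b c⟩⟩
  oplus_eq_one_iff a b := by
    rw [Part.eq_some_iff, compl_bot]
    constructor
    · rintro ⟨h1, h2⟩
      exact (IsCompl.of_eq h1 h2).compl_eq.symm
    · rintro rfl
      exact ⟨inf_compl_eq_bot, sup_compl_eq_top⟩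
  oplus_one_dom_iff a := by simp

/-- The unit interval as an effect algebra: `r ⊕ s = r + s`, defined iff `r + s ≤ 1`, and
`rᗮ = 1 - r`. -/
instance instUnitInterval : EffectAlgebra unitInterval where
  zero := 0
  oplus r s := ⟨(r : ℝ) + s ≤ 1, fun h => ⟨r + s, add_nonneg r.2.1 s.2.1, h⟩⟩
  compl r := unitInterval.symm r
  zero_oplus r := by
    rw [Part.eq_some_iff]
    exact ⟨by simpa using r.2.2, Subtype.ext (by simp)⟩
  oplus_comm r s := by
    refine Part.ext' ?_ ?_
    · simp [add_comm]
    · intro _ _; exact Subtype.ext (add_comm _ _)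
  oplus_assoc r s t := by
    have hr := r.2.1
    have ht := t.2.1
    ext e
    simp only [Part.mem_bind_iff]
    constructor
    · rintro ⟨d, ⟨h1, rfl⟩, ⟨h2, rfl⟩⟩
      change (r : ℝ) + s + t ≤ 1 at h2
      exact ⟨_, ⟨by change (s : ℝ) + t ≤ 1; linarith, rfl⟩,
        ⟨by change (r : ℝ) + (s + t) ≤ 1; linarith, Subtype.ext (add_assoc _ _ _).symm⟩⟩
    · rintro ⟨d, ⟨h1, rfl⟩, ⟨h2, rfl⟩⟩
      change (r : ℝ) + (s + t) ≤ 1 at h2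
      exact ⟨_, ⟨by change (r : ℝ) + s ≤ 1; linarith, rfl⟩,
        ⟨by change (r : ℝ) + s + t ≤ 1; linarith, Subtype.ext (add_assoc _ _ _)⟩⟩
  oplus_eq_one_iff r s := by
    rw [Part.eq_some_iff]
    constructor
    · rintro ⟨h1, h2⟩
      have h3 : (r : ℝ) + s = 1 := by simpa using congrArg Subtype.val h2
      exact Subtype.ext (by rw [unitInterval.coe_symm_eq]; linarith)
    · rintro rfl
      exact ⟨by simp, Subtype.ext (by simp)⟩
  oplus_one_dom_iff r := by
    have hr := r.2.1
    constructor
    · intro h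
      have h' : (r : ℝ) + (unitInterval.symm 0 : unitInterval) ≤ 1 := h
      simp only [unitInterval.symm_zero, Set.Icc.coe_one] at h'
      exact Subtype.ext (by change (r : ℝ) = 0; linarith)
    · rintro rfl
      change ((0 : unitInterval) : ℝ) + (unitInterval.symm 0 : unitInterval) ≤ 1
      simp

/-- Powers `A ^ X` of an effect algebra, with the pointwise structure. -/
instance instPi (X : Type v) (A : Type u) [EffectAlgebra A] : EffectAlgebra (X → A) where
  zero _ := zero
  oplus f g := ⟨∀ x, (oplus (f x) (g x)).Dom, fun h x => (oplus (f x) (g x)).get (h x)⟩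
  compl f x := compl (f x)
  zero_oplus f := by
    rw [Part.eq_some_iff]
    exact ⟨fun x => (mem_zero (f x)).1, funext fun x => (mem_zero (f x)).2⟩
  oplus_comm f g := by
    ext e
    constructor
    · rintro ⟨h, rfl⟩
      exact ⟨fun x => (mem_comm ⟨h x, rfl⟩).1, funext fun x => (mem_comm ⟨h x, rfl⟩).2⟩
    · rintro ⟨h, rfl⟩
      exact ⟨fun x => (mem_comm ⟨h x, rfl⟩).1, funext fun x => (mem_comm ⟨h x, rfl⟩).2⟩
  oplus_assoc f g k := by
    ext e
    simp only [Part.mem_bind_iff]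
    constructor
    · rintro ⟨d, ⟨h1, rfl⟩, ⟨h2, rfl⟩⟩
      choose a ha ha' using fun x => mem_assoc ⟨h1 x, rfl⟩ ⟨h2 x, rfl⟩
      exact ⟨a, ⟨fun x => (ha x).1, funext fun x => (ha x).2⟩,
        ⟨fun x => (ha' x).1, funext fun x => (ha' x).2⟩⟩
    · rintro ⟨d, ⟨h1, rfl⟩, ⟨h2, rfl⟩⟩
      choose a ha ha' using fun x => mem_assoc' ⟨h1 x, rfl⟩ ⟨h2 x, rfl⟩
      exact ⟨a, ⟨fun x => (ha x).1, funext fun x => (ha x).2⟩,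
        ⟨fun x => (ha' x).1, funext fun x => (ha' x).2⟩⟩
  oplus_eq_one_iff f g := by
    rw [Part.eq_some_iff]
    constructor
    · rintro ⟨h1, h2⟩
      exact funext fun x => one_mem_iff.1 ⟨h1 x, congrFun h2 x⟩
    · rintro rfl
      exact ⟨fun x => (one_mem (f x)).1, funext fun x => (one_mem (f x)).2⟩
  oplus_one_dom_iff f := by
    constructor
    · intro h
      exact funext fun x => (oplus_one_dom_iff (f x)).1 (h x)
    · rintro rfl x
      exact (oplus_one_dom_iff _).2 rfl

/-- The interval `[0, c]` in an effect algebra `A`. -/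
def Interval {A : Type u} [EffectAlgebra A] (c : A) : Type u := {x : A // ∃ y, c ∈ oplus x y}

/-- The interval `[0, c]` is an effect algebra with `⊕` restricted to those sums that
lie below `c`. -/
noncomputable instance instInterval {A : Type u} [EffectAlgebra A] (c : A) :
    EffectAlgebra (Interval c) :=
  ofRel (A := Interval c) ⟨zero, c, mem_zero c⟩
    (fun x => ⟨x.2.choose, x.1, mem_comm x.2.choose_spec⟩)
    (fun x y z => z.1 ∈ oplus x.1 y.1)
    (fun _ _ _ _ h h' => Subtype.ext (Part.mem_unique h h'))
    (fun x => mem_zero x.1)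
    (fun _ _ _ h => mem_comm h)
    (fun a b d e f h h' => by
      obtain ⟨t, ht, ht'⟩ := mem_assoc h h'
      obtain ⟨y, hy⟩ := f.2
      obtain ⟨s, hs, hs'⟩ := mem_assoc (mem_comm ht') hy
      exact ⟨⟨t, s, hs'⟩, ht, ht'⟩)
    (fun a b => by
      have h0 : ∀ z, c ∈ oplus zero z → z = c := fun z hz => (eq_of_mem_zero hz).symm
      have h1 := h0 _ (Exists.choose_spec (⟨c, mem_zero c⟩ : ∃ y, c ∈ oplus (zero : A) y))
      constructor
      · intro h
        change Exists.choose (⟨c, mem_zero c⟩ : ∃ y, c ∈ oplus (zero : A) y) ∈ _ at h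
        rw [h1] at h
        exact Subtype.ext (cancel h a.2.choose_spec)
      · rintro rfl
        change Exists.choose (⟨c, mem_zero c⟩ : ∃ y, c ∈ oplus (zero : A) y) ∈ _
        rw [h1]
        exact a.2.choose_spec)
    (fun a e h => by
      have h0 : ∀ z, c ∈ oplus zero z → z = c := fun z hz => (eq_of_mem_zero hz).symm
      have h1 := h0 _ (Exists.choose_spec (⟨c, mem_zero c⟩ : ∃ y, c ∈ oplus (zero : A) y))
      change e.1 ∈ oplus a.1 (Exists.choose (⟨c, mem_zero c⟩ : ∃ y, c ∈ oplus (zero : A) y)) at h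
      rw [h1] at h
      obtain ⟨y, hy⟩ := e.2
      obtain ⟨s, hs, hs'⟩ := mem_assoc (mem_comm h) hy
      have := cancel hs' (mem_comm (mem_zero c))
      subst this
      exact Subtype.ext (eq_zero_of_mem_zero hs))

theorem Interval.mem_iff {A : Type u} [EffectAlgebra A] {c : A} (x y z : Interval c) :
    z ∈ oplus x y ↔ z.1 ∈ oplus x.1 y.1 :=
  mem_relPart (R := fun x y z : Interval c => z.1 ∈ oplus x.1 y.1)
    fun _ _ _ _ h h' => Subtype.ext (Part.mem_unique h h')

theorem Interval.one_val {A : Type u} [EffectAlgebra A] {c : A} :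
    (one : Interval c).1 = c :=
  (eq_of_mem_zero (Exists.choose_spec (⟨c, mem_zero c⟩ : ∃ y, c ∈ oplus (zero : A) y))).symm

/-! ### The tensor product of effect algebras -/

/-- Formal expressions in pure tensors `a ⊗ b`. -/
inductive TensorTerm (A : Type u) (B : Type v) : Type (max u v)
  | zero : TensorTerm A B
  | tmul : A → B → TensorTerm A B
  | oplus : TensorTerm A B → TensorTerm A B → TensorTerm A B
  | compl : TensorTerm A B → TensorTerm A B

section tensor

variable {A : Type u} {B : Type v} [EffectAlgebra A] [EffectAlgebra B]

/-- The (partial) evaluation of an expression under a bilinear morphism. -/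
def TensorTerm.eval {C : Type w} [EffectAlgebra C] (β : Bimorphism A B C) :
    TensorTerm A B → Part C
  | .zero => Part.some EffectAlgebra.zero
  | .tmul a b => Part.some (β.toFun a b)
  | .oplus s t => (s.eval β).bind fun x => (t.eval β).bind fun y => EffectAlgebra.oplus x y
  | .compl t => (t.eval β).map EffectAlgebra.compl

/-- Expressions whose value is defined under every bilinear morphism, identified if they have the
same value under every bilinear morphism. -/
def tensorSetoid (A : Type u) (B : Type v) [EffectAlgebra A] [EffectAlgebra B] :
    Setoid {t : TensorTerm A B // ∀ (C : Type (max u v)) [EffectAlgebra C] (β : Bimorphism A B C),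
      (t.eval β).Dom} where
  r s t := ∀ (C : Type (max u v)) [EffectAlgebra C] (β : Bimorphism A B C),
    s.1.eval β = t.1.eval β
  iseqv := ⟨fun _ _ _ _ => rfl, fun h C _ β => (h C β).symm,
    fun h h' C _ β => (h C β).trans (h' C β)⟩

/-- The tensor product `A ⊗ B` of effect algebras, which represents bilinear morphisms
(see `tmul` and `tensorLift` for the universal bilinear morphism and the universal property). -/
def Tensor (A : Type u) (B : Type v) [EffectAlgebra A] [EffectAlgebra B] : Type (max u v) :=
  Quotient (tensorSetoid A B)

namespace Tensor

/-- The value of an element of `A ⊗ B` under a bilinear morphism. -/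
def val {C : Type (max u v)} [EffectAlgebra C] (β : Bimorphism A B C) : Tensor A B → C :=
  Quotient.lift (fun t => (t.1.eval β).get (t.2 C β)) (fun s t h => by
    have h' : s.1.eval β = t.1.eval β := h C β
    exact Part.get_eq_get_of_eq _ _ h')

theorem val_ext {x y : Tensor A B}
    (h : ∀ (C : Type (max u v)) [EffectAlgebra C] (β : Bimorphism A B C), val β x = val β y) :
    x = y := by
  induction x using Quotient.inductionOn with | _ s
  induction y using Quotient.inductionOn with | _ t
  refine Quotient.sound fun C _ β => ?_
  refine Part.ext' ⟨fun _ => t.2 C β, fun _ => s.2 C β⟩ fun _ _ => h C β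

theorem mem_eval {C : Type (max u v)} [EffectAlgebra C] (β : Bimorphism A B C)
    (t : {t : TensorTerm A B // ∀ (C : Type (max u v)) [EffectAlgebra C] (β : Bimorphism A B C),
      (t.eval β).Dom}) : val β (Quotient.mk _ t) ∈ t.1.eval β :=
  Part.get_mem (t.2 C β)

/-- The zero element. -/
def zero : Tensor A B := Quotient.mk _ ⟨.zero, fun _ _ _ => trivial⟩

/-- The orthocomplement. -/
def compl : Tensor A B → Tensor A B :=
  Quotient.map (fun t => ⟨.compl t.1, fun C _ β => t.2 C β⟩) (fun s t h C _ β => by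
    change (s.1.eval β).map _ = (t.1.eval β).map _
    rw [h C β])

theorem val_zero {C : Type (max u v)} [EffectAlgebra C] (β : Bimorphism A B C) :
    val β zero = EffectAlgebra.zero := rfl

theorem val_compl {C : Type (max u v)} [EffectAlgebra C] (β : Bimorphism A B C)
    (x : Tensor A B) : val β (compl x) = EffectAlgebra.compl (val β x) := by
  induction x using Quotient.inductionOn with | _ t
  rfl

/-- `z = x ⊕ y` holds under every bilinear morphism. -/
def Rel (x y z : Tensor A B) : Prop :=
  ∀ (C : Type (max u v)) [EffectAlgebra C] (β : Bimorphism A B C),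
    val β z ∈ oplus (val β x) (val β y)

theorem exists_rel (x y : Tensor A B)
    (h : ∀ (C : Type (max u v)) [EffectAlgebra C] (β : Bimorphism A B C),
      (oplus (val β x) (val β y)).Dom) : ∃ z, Rel x y z := by
  induction x using Quotient.inductionOn with | _ s
  induction y using Quotient.inductionOn with | _ t
  have key : ∀ (C : Type (max u v)) [EffectAlgebra C] (β : Bimorphism A B C) (c : C),
      c ∈ oplus (val β (Quotient.mk _ s)) (val β (Quotient.mk _ t)) →
      c ∈ (TensorTerm.oplus s.1 t.1).eval β := by
    intro C _ β c hc
    exact Part.mem_bind_iff.2 ⟨_, mem_eval β s, Part.mem_bind_iff.2 ⟨_, mem_eval β t, hc⟩⟩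
  have hd : ∀ (C : Type (max u v)) [EffectAlgebra C] (β : Bimorphism A B C),
      ((TensorTerm.oplus s.1 t.1).eval β).Dom := fun C _ β => (key C β _ (Part.get_mem (h C β))).1
  refine ⟨Quotient.mk _ ⟨.oplus s.1 t.1, hd⟩, ?_⟩
  intro C _ β
  have h1 := Part.get_mem (h C β)
  have h2 := Part.mem_unique (key C β _ h1) (mem_eval β ⟨.oplus s.1 t.1, hd⟩)
  rwa [h2] at h1

noncomputable instance : EffectAlgebra (Tensor A B) :=
  ofRel zero compl Rel
    (fun _ _ _ _ h h' => val_ext fun C _ β => Part.mem_unique (h C β) (h' C β))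
    (fun _ _ _ _ => mem_zero _)
    (fun _ _ _ h C _ β => mem_comm (h C β))
    (fun a b c d e h h' => by
      have : ∃ f, Rel b c f := exists_rel b c fun C _ β => by
        obtain ⟨f, hf, -⟩ := mem_assoc (h C β) (h' C β)
        exact hf.1
      obtain ⟨f, hf⟩ := this
      refine ⟨f, hf, fun C _ β => ?_⟩
      obtain ⟨f', hf', he⟩ := mem_assoc (h C β) (h' C β)
      rwa [Part.mem_unique hf' (hf C β)] at he)
    (fun a b => by
      constructor
      · intro h
        refine val_ext fun C _ β => ?_
        have := h C β
        rw [val_compl, val_zero] at this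
        rw [val_compl]
        exact one_mem_iff.1 this
      · rintro rfl C _ β
        rw [val_compl, val_compl, val_zero]
        exact one_mem _)
    (fun a c h => val_ext fun C _ β => by
      have := h C β
      rw [val_compl, val_zero] at this
      exact (oplus_one_dom_iff _).1 this.1)

theorem mem_iff (x y z : Tensor A B) :
    z ∈ oplus x y ↔ ∀ (C : Type (max u v)) [EffectAlgebra C] (β : Bimorphism A B C),
      val β z ∈ oplus (val β x) (val β y) :=
  mem_relPart (R := Rel) fun _ _ _ _ h h' => val_ext fun C _ β => Part.mem_unique (h C β) (h' C β)

end Tensor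

/-- The universal bilinear morphism `(a, b) ↦ a ⊗ b`. -/
noncomputable def tmul (A : Type u) (B : Type v) [EffectAlgebra A] [EffectAlgebra B] :
    Bimorphism A B (Tensor A B) where
  toFun a b := Quotient.mk _ ⟨.tmul a b, fun _ _ _ => trivial⟩
  zero_left b := Tensor.val_ext fun _ _ β => β.zero_left b
  zero_right a := Tensor.val_ext fun _ _ β => β.zero_right a
  oplus_left a a' a'' b h := (Tensor.mem_iff _ _ _).2 fun _ _ β => β.oplus_left a a' a'' b h
  oplus_right a b b' b'' h := (Tensor.mem_iff _ _ _).2 fun _ _ β => β.oplus_right a b b' b'' h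
  one_one := Tensor.val_ext fun _ _ β => β.one_one

/-- Existence part of the universal property: every bilinear morphism `A × B → C`
extends to a morphism `A ⊗ B → C`. -/
def tensorLift {C : Type (max u v)} [EffectAlgebra C] (β : Bimorphism A B C) :
    Hom (Tensor A B) C where
  toFun := Tensor.val β
  map_zero := Tensor.val_zero β
  map_compl := Tensor.val_compl β
  map_oplus _ _ _ h := (Tensor.mem_iff _ _ _).1 h C β

theorem tensorLift_tmul {C : Type (max u v)} [EffectAlgebra C] (β : Bimorphism A B C)
    (a : A) (b : B) : (tensorLift β).toFun ((tmul A B).toFun a b) = β.toFun a b := rfl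

/-- The element of `A ⊗ B` given by an expression. -/
def Tensor.mk (t : TensorTerm A B) (ht : ∀ (C : Type (max u v)) [EffectAlgebra C]
    (β : Bimorphism A B C), (t.eval β).Dom) : Tensor A B :=
  Quotient.mk _ ⟨t, ht⟩

/-- Uniqueness part of the universal property, for maps that preserve `⊕`. -/
theorem Tensor.funext_of_additive {C : Type w} [EffectAlgebra C] {f g : Tensor A B → C}
    (hf : ∀ a b c, c ∈ oplus a b → f c ∈ oplus (f a) (f b))
    (hg : ∀ a b c, c ∈ oplus a b → g c ∈ oplus (g a) (g b))
    (h : ∀ a b, f ((tmul A B).toFun a b) = g ((tmul A B).toFun a b)) : f = g := by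
  have f0 : f EffectAlgebra.zero = EffectAlgebra.zero :=
    eq_zero_of_mem_left (hf EffectAlgebra.zero EffectAlgebra.zero EffectAlgebra.zero (mem_zero EffectAlgebra.zero))
  have g0 : g EffectAlgebra.zero = EffectAlgebra.zero :=
    eq_zero_of_mem_left (hg EffectAlgebra.zero EffectAlgebra.zero EffectAlgebra.zero (mem_zero EffectAlgebra.zero))
  have h1 : f one = g one := by rw [← (tmul A B).one_one]; exact h _ _
  have key : ∀ (t : TensorTerm A B) (ht : ∀ (C : Type (max u v)) [EffectAlgebra C]
      (β : Bimorphism A B C), (t.eval β).Dom),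
      f (Tensor.mk t ht) = g (Tensor.mk t ht) := by
    intro t
    induction t with
    | zero => intro _; exact f0.trans g0.symm
    | tmul a b => intro _; exact h a b
    | oplus s t ihs iht =>
      intro ht
      have hs' : ∀ (C : Type (max u v)) [EffectAlgebra C]
          (β : Bimorphism A B C), (s.eval β).Dom := by
        intro C _ β
        obtain ⟨c, hc⟩ := Part.dom_iff_mem.1 (ht C β)
        obtain ⟨x, hx, -⟩ := Part.mem_bind_iff.1 hc
        exact hx.1
      have ht' : ∀ (C : Type (max u v)) [EffectAlgebra C]
          (β : Bimorphism A B C), (t.eval β).Dom := by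
        intro C _ β
        obtain ⟨c, hc⟩ := Part.dom_iff_mem.1 (ht C β)
        obtain ⟨x, hx, hc⟩ := Part.mem_bind_iff.1 hc
        obtain ⟨y, hy, -⟩ := Part.mem_bind_iff.1 hc
        exact hy.1
      have hm : (Tensor.mk (.oplus s t) ht) ∈
          EffectAlgebra.oplus (Tensor.mk s hs')
            (Tensor.mk t ht') := by
        refine (Tensor.mem_iff _ _ _).2 fun C _ β => ?_
        obtain ⟨x, hx, hc⟩ := Part.mem_bind_iff.1 (Tensor.mem_eval β ⟨.oplus s t, ht⟩)
        obtain ⟨y, hy, hc⟩ := Part.mem_bind_iff.1 hc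
        rw [Part.mem_unique hx (Tensor.mem_eval β ⟨s, hs'⟩),
          Part.mem_unique hy (Tensor.mem_eval β ⟨t, ht'⟩)] at hc
        exact hc
      have h1 := hf _ _ _ hm
      have h2 := hg _ _ _ hm
      rw [ihs, iht] at h1
      exact Part.mem_unique h1 h2
    | compl t iht =>
      intro ht
      have hm := one_mem (Tensor.mk t ht)
      have e1 := hf _ _ _ hm
      have e2 := hg _ _ _ hm
      rw [h1, iht ht] at e1
      exact cancel e1 e2
  funext x
  induction x using Quotient.inductionOn with | _ t
  exact key t.1 t.2

end tensor

end EffectAlgebra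

open EffectAlgebra

/-! ### Effect modules -/

/-- An effect module: an effect algebra `E` with a bilinear map `[0,1] × E → E` of effect algebras
that is an action of the multiplicative monoid `[0,1]`. -/
class EffectModule (E : Type u) extends EffectAlgebra E where
  action : Bimorphism unitInterval E E
  one_action : ∀ x, action.toFun 1 x = x
  mul_action : ∀ r s x, action.toFun (r * s) x = action.toFun r (action.toFun s x)

/-- The unit interval as an effect module over itself. -/
instance instModuleUnitInterval : EffectModule unitInterval where
  action :=
    { toFun := fun r s => r * s
      zero_left := fun s => zero_mul s
      zero_right := fun r => mul_zero r
      oplus_left := by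
        rintro a a' _ b ⟨h, rfl⟩
        have hb := b.2
        have ha : (a : ℝ) + a' ≤ 1 := h
        exact ⟨by
          change (a : ℝ) * b + a' * b ≤ 1
          nlinarith [hb.1, hb.2, a.2.1, a'.2.1], Subtype.ext (add_mul (a : ℝ) a' b).symm⟩
      oplus_right := by
        rintro b a a' _ ⟨h, rfl⟩
        have hb := b.2
        have ha : (a : ℝ) + a' ≤ 1 := h
        exact ⟨by
          change (b : ℝ) * a + b * a' ≤ 1
          nlinarith [hb.1, hb.2, a.2.1, a'.2.1], Subtype.ext (mul_add (b : ℝ) a a').symm⟩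
      one_one := by
        change unitInterval.symm 0 * unitInterval.symm 0 = unitInterval.symm 0
        simp }
  one_action := fun s => one_mul s
  mul_action := fun r s t => mul_assoc r s t

/-- Powers `E ^ X` of an effect module, with the pointwise structure. -/
instance instModulePi (X : Type v) (E : Type u) [EffectModule E] : EffectModule (X → E) where
  action :=
    { toFun := fun r f x => EffectModule.action.toFun r (f x)
      zero_left := fun f => funext fun x => Bimorphism.zero_left _ (f x)
      zero_right := fun r => funext fun x => Bimorphism.zero_right _ r
      oplus_left := fun a a' a'' f h =>
        ⟨fun x => (Bimorphism.oplus_left EffectModule.action a a' a'' (f x) h).1,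
          funext fun x => (Bimorphism.oplus_left EffectModule.action a a' a'' (f x) h).2⟩
      oplus_right := by
        rintro r f g _ ⟨h, rfl⟩
        exact ⟨fun x => (Bimorphism.oplus_right EffectModule.action r (f x) (g x) _ ⟨h x, rfl⟩).1,
          funext fun x =>
            (Bimorphism.oplus_right EffectModule.action r (f x) (g x) _ ⟨h x, rfl⟩).2⟩
      one_one := funext fun x => Bimorphism.one_one EffectModule.action }
  one_action := fun f => funext fun x => EffectModule.one_action (f x)
  mul_action := fun r s f => funext fun x => EffectModule.mul_action r s (f x)

/-! ### The action of `[0,1]` on `[0,1] ⊗ A` -/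

namespace EffectAlgebra

section scalars

variable (A : Type u) [EffectAlgebra A]

/-- For `r` in `[0,1]`, the bilinear map `(s, a) ↦ rs ⊗ a` into the interval `[0, r ⊗ 1]`. -/
noncomputable def scaleBimorphism (r : unitInterval) :
    Bimorphism unitInterval A (Interval ((tmul unitInterval A).toFun r one)) where
  toFun s a := ⟨(tmul unitInterval A).toFun (r * s) a, by
    have h1 := (tmul unitInterval A).oplus_right (r * s) _ _ _ (one_mem a)
    have h2 := instModuleUnitInterval.action.oplus_right r _ _ _ (one_mem s)
    have h3 := (tmul unitInterval A).oplus_left _ _ _ (one : A) h2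
    have h4 : instModuleUnitInterval.action.toFun r one = r := by
      change r * unitInterval.symm 0 = r
      simp
    rw [h4] at h3
    obtain ⟨f, -, hf⟩ := mem_assoc h1 h3
    exact ⟨f, hf⟩⟩
  zero_left a := Subtype.ext (by
    have : r * (zero : unitInterval) = zero := mul_zero r
    change (tmul unitInterval A).toFun (r * zero) a = zero
    rw [this, (tmul unitInterval A).zero_left])
  zero_right s := Subtype.ext ((tmul unitInterval A).zero_right (r * s))
  oplus_left s s' s'' a h := (Interval.mem_iff _ _ _).2
    ((tmul unitInterval A).oplus_left _ _ _ a
      (instModuleUnitInterval.action.oplus_right r _ _ _ h))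
  oplus_right s a a' a'' h := (Interval.mem_iff _ _ _).2
    ((tmul unitInterval A).oplus_right (r * s) _ _ _ h)
  one_one := Subtype.ext (by
    rw [Interval.one_val]
    change (tmul unitInterval A).toFun (r * unitInterval.symm 0) one = _
    simp)

/-- Multiplication by the scalar `r` on `[0,1] ⊗ A`, determined by `r • (s ⊗ a) = rs ⊗ a`. -/
noncomputable def scale (r : unitInterval) (x : Tensor unitInterval A) : Tensor unitInterval A :=
  ((tensorLift (scaleBimorphism A r)).toFun x).1

variable {A}

theorem scale_tmul (r s : unitInterval) (a : A) :
    scale A r ((tmul unitInterval A).toFun s a) = (tmul unitInterval A).toFun (r * s) a := rfl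

theorem scale_additive (r : unitInterval) (x y z : Tensor unitInterval A) (h : z ∈ oplus x y) :
    scale A r z ∈ oplus (scale A r x) (scale A r y) :=
  (Interval.mem_iff _ _ _).1 ((tensorLift (scaleBimorphism A r)).map_oplus _ _ _ h)

theorem scale_one (x : Tensor unitInterval A) : scale A 1 x = x := by
  refine congrFun (Tensor.funext_of_additive (f := scale A 1) (g := fun x => x)
    (scale_additive 1) (fun _ _ _ h => h) fun r a => ?_) x
  rw [scale_tmul, one_mul]

theorem scale_mul (r s : unitInterval) (x : Tensor unitInterval A) :
    scale A (r * s) x = scale A r (scale A s x) := by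
  refine congrFun (Tensor.funext_of_additive (f := scale A (r * s))
    (g := fun x => scale A r (scale A s x))
    (scale_additive _) (fun _ _ _ h => scale_additive r _ _ _ (scale_additive s _ _ _ h))
    fun t a => ?_) x
  simp only [scale_tmul, mul_assoc]

theorem scale_oplus (r s t : unitInterval) (h : t ∈ oplus r s) (x : Tensor unitInterval A) :
    scale A t x ∈ oplus (scale A r x) (scale A s x) := by
  have hd : ∀ x, (oplus (scale A r x) (scale A s x)).Dom := fun x => by
    obtain ⟨p, hp⟩ := ((tensorLift (scaleBimorphism A r)).toFun x).2
    obtain ⟨q, hq⟩ := ((tensorLift (scaleBimorphism A s)).toFun x).2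
    exact dom_mono hp hq ((tmul unitInterval A).oplus_left _ _ _ one h).1
  choose g hg using fun x => Part.dom_iff_mem.1 (hd x)
  have : scale A t = g := by
    refine Tensor.funext_of_additive (scale_additive t) ?_ ?_
    · intro x y z hz
      exact mem_exchange (scale_additive r _ _ _ hz) (scale_additive s _ _ _ hz) (hg x) (hg y)
        (hg z)
    · intro p a
      refine Part.mem_unique ?_ (hg _)
      simp only [scale_tmul]
      exact (tmul unitInterval A).oplus_left _ _ _ a
        (instModuleUnitInterval.action.oplus_left _ _ _ p h)
  rw [this]
  exact hg x

/-- The effect module `[0,1] ⊗ A`. -/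
noncomputable instance instModuleTensor : EffectModule (Tensor unitInterval A) where
  action :=
    { toFun := scale A
      zero_left := fun x => eq_zero_of_mem_left (scale_oplus _ _ _ (mem_zero (zero : unitInterval)) x)
      zero_right := fun r => eq_zero_of_mem_left (scale_additive r _ _ _ (mem_zero zero))
      oplus_left := fun r s t x h => scale_oplus r s t h x
      oplus_right := fun r x y z h => scale_additive r x y z h
      one_one := by
        have : (one : unitInterval) = 1 := unitInterval.symm_zero
        rw [this, scale_one] }
  one_action := scale_one
  mul_action := scale_mul

end scalars

end EffectAlgebra

/-! ### The categories `EA` and `EMod` -/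

/-- The category of effect algebras. -/
structure EA : Type (u + 1) where
  carrier : Type u
  [str : EffectAlgebra carrier]

attribute [instance] EA.str

/-- Composition of morphisms of effect algebras. -/
def EffectAlgebra.Hom.comp {A : Type u} {B : Type v} {C : Type w} [EffectAlgebra A]
    [EffectAlgebra B] [EffectAlgebra C] (f : Hom A B) (g : Hom B C) : Hom A C where
  toFun a := g.toFun (f.toFun a)
  map_zero := by rw [f.map_zero, g.map_zero]
  map_compl a := by rw [f.map_compl, g.map_compl]
  map_oplus a b c h := g.map_oplus _ _ _ (f.map_oplus _ _ _ h)

instance : Category EA.{u} where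
  Hom A B := Hom A.carrier B.carrier
  id A := ⟨fun a => a, rfl, fun _ => rfl, fun _ _ _ h => h⟩
  comp f g := f.comp g

/-- A morphism of effect modules is a morphism of effect algebras preserving the action. -/
@[ext]
structure EffectModuleHom (E : Type u) (F : Type v) [EffectModule E] [EffectModule F]
    extends Hom E F where
  map_action : ∀ r x,
    toFun (EffectModule.action.toFun r x) = EffectModule.action.toFun r (toFun x)

/-- The category of effect modules. -/
structure EMod : Type (u + 1) where
  carrier : Type u
  [str : EffectModule carrier]

attribute [instance] EMod.str

/-- Composition of morphisms of effect modules. -/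
def EffectModuleHom.comp {E : Type u} {F : Type v} {G : Type w} [EffectModule E]
    [EffectModule F] [EffectModule G] (f : EffectModuleHom E F) (g : EffectModuleHom F G) :
    EffectModuleHom E G where
  toHom := f.toHom.comp g.toHom
  map_action r x := by
    change g.toFun (f.toFun _) = EffectModule.action.toFun r (g.toFun (f.toFun x))
    rw [f.map_action, g.map_action]

instance : Category EMod.{u} where
  Hom E F := EffectModuleHom E.carrier F.carrier
  id A := ⟨⟨fun a => a, rfl, fun _ => rfl, fun _ _ _ h => h⟩, fun _ _ => rfl⟩
  comp f g := f.comp g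

/-- The forgetful functor `EMod ⥤ EA`. -/
def forgetEMod : EMod.{u} ⥤ EA.{u} where
  obj E := ⟨E.carrier⟩
  map f := f.toHom

/-! ### The free effect module functor and the monad `M = [0,1] ⊗ -` -/

namespace FreeEffectModule

/-- The morphism `a ↦ 1 ⊗ a`. -/
noncomputable def unit (A : Type u) [EffectAlgebra A] : Hom A (Tensor unitInterval A) where
  toFun a := (tmul unitInterval A).toFun 1 a
  map_zero := (tmul unitInterval A).zero_right 1
  map_compl a := by
    have h := (tmul unitInterval A).oplus_right 1 _ _ _ (one_mem a)
    have h1 : (one : unitInterval) = 1 := unitInterval.symm_zero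
    have h2 : (tmul unitInterval A).toFun 1 one = one := by
      rw [← h1]; exact (tmul unitInterval A).one_one
    rw [h2] at h
    exact one_mem_iff.1 h
  map_oplus a b c h := (tmul unitInterval A).oplus_right 1 a b c h

/-- The bilinear morphism `(r, a) ↦ r • f a`. -/
def bimorphism {A E : Type u} [EffectAlgebra A] [EffectModule E] (f : Hom A E) :
    Bimorphism unitInterval A E where
  toFun r a := EffectModule.action.toFun r (f.toFun a)
  zero_left a := Bimorphism.zero_left _ _
  zero_right r := by rw [f.map_zero, Bimorphism.zero_right]
  oplus_left r s t a h := Bimorphism.oplus_left EffectModule.action r s t _ h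
  oplus_right r a b c h := Bimorphism.oplus_right EffectModule.action r _ _ _ (f.map_oplus _ _ _ h)
  one_one := by rw [f.map_one, Bimorphism.one_one]

/-- The morphism `[0,1] ⊗ A → E`, `r ⊗ a ↦ r • f a`, of effect modules. -/
def lift {A E : Type u} [EffectAlgebra A] [EffectModule E] (f : Hom A E) :
    EffectModuleHom (Tensor unitInterval A) E where
  toHom := tensorLift (bimorphism f)
  map_action r x := by
    refine congrFun (Tensor.funext_of_additive
      (f := fun x => (tensorLift (bimorphism f)).toFun (scale A r x))
      (g := fun x => EffectModule.action.toFun r ((tensorLift (bimorphism f)).toFun x))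
      (fun _ _ _ h => Hom.map_oplus _ _ _ _ (scale_additive r _ _ _ h))
      (fun _ _ _ h => Bimorphism.oplus_right EffectModule.action r _ _ _
        (Hom.map_oplus _ _ _ _ h)) fun s a => ?_) x
    simp only [scale_tmul, tensorLift_tmul]
    exact EffectModule.mul_action r s _

theorem hom_ext {A E : Type u} [EffectAlgebra A] [EffectModule E]
    {f g : EffectModuleHom (Tensor unitInterval A) E}
    (h : ∀ a, f.toFun ((unit A).toFun a) = g.toFun ((unit A).toFun a)) : f = g := by
  refine EffectModuleHom.ext (Tensor.funext_of_additive f.map_oplus g.map_oplus fun r a => ?_)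
  have : (tmul unitInterval A).toFun r a =
      EffectModule.action.toFun r ((unit A).toFun a) := by
    change _ = (tmul unitInterval A).toFun (r * 1) a
    rw [mul_one]
  rw [this, f.map_action, g.map_action, h]

theorem lift_unit {A E : Type u} [EffectAlgebra A] [EffectModule E] (f : Hom A E) (a : A) :
    (lift f).toFun ((unit A).toFun a) = f.toFun a :=
  EffectModule.one_action _

theorem lift_comp {A E F : Type u} [EffectAlgebra A] [EffectModule E] [EffectModule F]
    (f : Hom A E) (g : EffectModuleHom E F) (h : Hom A F)
    (w : ∀ a, g.toFun (f.toFun a) = h.toFun a) : lift h = (lift f).comp g := by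
  refine hom_ext fun a => ?_
  change _ = g.toFun ((lift f).toFun ((unit A).toFun a))
  rw [lift_unit, lift_unit, w]

end FreeEffectModule

/-- The functor `A ↦ [0,1] ⊗ A` from effect algebras to effect modules; it sends `f` to
`r ⊗ a ↦ r ⊗ f a`. -/
noncomputable def freeEMod : EA.{u} ⥤ EMod.{u} where
  obj A := ⟨Tensor unitInterval A.carrier⟩
  map f := FreeEffectModule.lift (f.comp (FreeEffectModule.unit _))
  map_id A := FreeEffectModule.hom_ext fun a => FreeEffectModule.lift_unit _ a
  map_comp {A B C} f g := FreeEffectModule.lift_comp (f.comp (FreeEffectModule.unit _)) _ _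
    fun a => by
      change (FreeEffectModule.lift _).toFun ((FreeEffectModule.unit B.carrier).toFun _) = _
      exact FreeEffectModule.lift_unit _ _

/-- The functor `A ↦ [0,1] ⊗ A` is left adjoint to the forgetful functor; the unit is
`a ↦ 1 ⊗ a`. -/
noncomputable def freeForgetAdj : freeEMod.{u} ⊣ forgetEMod.{u} :=
  Adjunction.mkOfHomEquiv
    { homEquiv := fun A E =>
        { toFun := fun h =>
            (show A ⟶ forgetEMod.obj (freeEMod.obj A) from FreeEffectModule.unit A.carrier) ≫
              forgetEMod.map h
          invFun := fun f => FreeEffectModule.lift (E := E.carrier) f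
          left_inv := fun h => FreeEffectModule.hom_ext fun a =>
            FreeEffectModule.lift_unit (E := E.carrier) _ a
          right_inv := fun f => Hom.ext (funext fun a =>
            FreeEffectModule.lift_unit (E := E.carrier) f a) }
      homEquiv_naturality_left_symm := fun {A B E} f g =>
        FreeEffectModule.lift_comp (E := Tensor unitInterval B.carrier) (F := E.carrier)
          (f.comp (FreeEffectModule.unit _)) (FreeEffectModule.lift (E := E.carrier) g) _
          fun a => FreeEffectModule.lift_unit (E := E.carrier) g (f.toFun a)
      homEquiv_naturality_right := fun f g => rfl }

theorem kleisliComparison_aux {C : Type*} {D : Type*} [Category C] [Category D] {L : C ⥤ D}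
    {R : D ⥤ C} (adj : L ⊣ R) {X Y Z : C} (f : X ⟶ R.obj (L.obj Y)) (g : Y ⟶ R.obj (L.obj Z)) :
    L.map (f ≫ R.map (L.map g) ≫ R.map (adj.counit.app (L.obj Z))) ≫ adj.counit.app (L.obj Z) =
      (L.map f ≫ adj.counit.app (L.obj Y)) ≫ L.map g ≫ adj.counit.app (L.obj Z) := by
  simp

/-- The canonical functor from the Kleisli category of the monad `R L` of an adjunction `L ⊣ R`,
with `L : C ⥤ D`, to the category `D`: it sends `X` to `L X`, and a Kleisli morphism
`X ⟶ R (L Y)` to its transpose `L X ⟶ L Y`. -/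
def kleisliComparison {C : Type*} {D : Type*} [Category C] [Category D] {L : C ⥤ D} {R : D ⥤ C}
    (adj : L ⊣ R) : Kleisli adj.toMonad ⥤ D where
  obj X := L.obj X.of
  map {X Y} f := L.map f.of ≫ adj.counit.app (L.obj Y.of)
  map_id X := adj.left_triangle_components X.of
  map_comp f g := kleisliComparison_aux adj f.of g.of

/-- The monad `M = [0,1] ⊗ -` on effect algebras. -/
noncomputable abbrev monadM : Monad EA.{u} := freeForgetAdj.{u}.toMonad

/-- A finite Boolean algebra, as an object of the Kleisli category of `M`. -/
def FinBoolAlg.toKleisli (B : FinBoolAlg.{u}) : Kleisli monadM.{u} :=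
  Kleisli.mk monadM { carrier := B, str := ofBooleanAlgebra B }

/-- The full subcategory of the Kleisli category of `M` on finite Boolean algebras. -/
abbrev KleisliFinBoolAlg : Type (u + 1) :=
  InducedCategory (Kleisli monadM.{u}) FinBoolAlg.toKleisli.{u}

/-- The inclusion of the full subcategory of the Kleisli category of `M` on finite Boolean
algebras into the category of effect modules. -/
noncomputable def inclusionM : KleisliFinBoolAlg.{u} ⥤ EMod.{u} :=
  inducedFunctor FinBoolAlg.toKleisli ⋙ kleisliComparison freeForgetAdj

/-- The finite Boolean algebra `2 ^ X` of subsets of a finite set `X`. -/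
noncomputable def powersetAlg (X : Type u) [Fintype X] : KleisliFinBoolAlg.{u} :=
  FinBoolAlg.of (Set X)

/-- The effect module `[0,1] ^ X`. -/
def cubeEMod (X : Type u) : EMod.{u} := ⟨X → unitInterval⟩

/-- The element `1 ⊗ S` of `[0,1] ⊗ 2 ^ X`, for a subset `S` of `X`. -/
noncomputable def oneTensor (X : Type u) [Fintype X] (S : Set X) :
    (inclusionM.obj (powersetAlg X)).carrier :=
  letI := ofBooleanAlgebra (Set X)
  (tmul unitInterval (Set X)).toFun 1 S

/-! ### Finite sums in effect algebras -/

/-! Full faithfulness is formal. For any adjunction `L ⊣ R` the comparison functor acts on Kleisli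
morphisms by the hom-set bijection of the adjunction (`kleisliComparison_map`), and restricting to a
full subcategory keeps this.

The isomorphism with the cube rests on partitions of unity, that is, families `e : X → E` with
finite sum `1`. For finite `X`, a morphism out of `2 ^ X` is determined by its values on atoms,
which form such a family (`of_hom_set`, `sum_of_hom_singleton`). Conversely, `cubeLift` turns a
family into the effect module morphism `r ↦ ⨁ r x • e x` on the cube. Thus `[0,1] ⊗ 2 ^ X` and
`[0,1] ^ X` both classify partitions of unity indexed by `X`, and the two comparison maps are
inverse because they match the atoms. The partial sums are handled in `FormalSum`, where addition is
total.

For density, the single Boolean algebra `2 ^ 3` suffices to build the descent map. An equation `d =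
a ⊕ b` in `E` is the same as the partition of unity `(a, b, dᗮ)`, hence a morphism `triple h` from
`[0,1] ⊗ 2 ^ 3` to `E`. So every element, and every defined sum, of `E` is the image of one in some
object of the canonical diagram (`exists_arrow`). A cocone yields a map out of `E` by evaluating its
leg at the triple of `e = 0 ⊕ e`. This map is compatible with all legs (`coconeDesc_hom`), so each
operation may be checked inside one diagram object, where the leg preserves it. Uniqueness holds
because the arrows of the diagram are jointly surjective onto `E`. -/

namespace EffectAlgebra

/-- Possibly undefined elements of `A`; the partial operation of `A` turns them into a
commutative monoid, in which finite sums are available. -/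
def FormalSum (A : Type u) : Type u := Part A

namespace FormalSum

section

variable {A : Type u} [EffectAlgebra A]

/-- An element of `A`, as a formal sum. -/
def of {A : Type u} (a : A) : FormalSum A := Part.some a

instance : Add (FormalSum A) :=
  ⟨fun x y => Part.bind x fun a => Part.bind y fun b => oplus a b⟩

instance : Zero (FormalSum A) := ⟨of zero⟩

/-- A defined sum forces both summands to be defined. The definedness arguments for finite sums
below reduce to this. -/
theorem add_eq_of_iff {x y : FormalSum A} {c : A} :
    x + y = of c ↔ ∃ a b, x = of a ∧ y = of b ∧ c ∈ oplus a b := by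
  constructor
  · intro h
    obtain ⟨a, ha, h⟩ := Part.mem_bind_iff.1 (Part.eq_some_iff.1 h)
    obtain ⟨b, hb, h⟩ := Part.mem_bind_iff.1 h
    exact ⟨a, b, Part.eq_some_iff.2 ha, Part.eq_some_iff.2 hb, h⟩
  · rintro ⟨a, b, rfl, rfl, h⟩
    exact Part.eq_some_iff.2
      (Part.mem_bind_iff.2 ⟨a, Part.mem_some a, Part.mem_bind_iff.2 ⟨b, Part.mem_some b, h⟩⟩)

theorem ext_of {A : Type u} {x y : FormalSum A} (h : ∀ c, x = of c ↔ y = of c) : x = y :=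
  Part.ext fun c => Part.eq_some_iff.symm.trans ((h c).trans Part.eq_some_iff)

theorem of_injective {A : Type u} : Function.Injective (of : A → FormalSum A) :=
  Part.some_injective

/-- Undefinedness is absorbing, so the Kleene laws of `⊕` become the ordinary laws of a total
addition. By `ext_of` only defined values need to be compared. -/
instance : AddCommMonoid (FormalSum A) where
  nsmul := nsmulRec
  add_assoc x y z := ext_of fun t => by
    simp only [add_eq_of_iff]
    constructor
    · rintro ⟨d, c, ⟨a, b, ha, hb, hd⟩, hc, ht⟩
      obtain ⟨f, hf, ht'⟩ := mem_assoc hd ht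
      exact ⟨a, f, ha, ⟨b, c, hb, hc, hf⟩, ht'⟩
    · rintro ⟨a, f, ha, ⟨b, c, hb, hc, hf⟩, ht⟩
      obtain ⟨d, hd, ht'⟩ := mem_assoc' hf ht
      exact ⟨d, c, ⟨a, b, ha, hb, hd⟩, hc, ht'⟩
  zero_add x := ext_of fun t => by
    rw [add_eq_of_iff]
    constructor
    · rintro ⟨a, b, ha, rfl, h⟩
      rw [← of_injective ha] at h
      rw [eq_of_mem_zero h]
    · rintro rfl
      exact ⟨zero, t, rfl, rfl, mem_zero t⟩
  add_zero x := ext_of fun t => by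
    rw [add_eq_of_iff]
    constructor
    · rintro ⟨a, b, rfl, hb, h⟩
      rw [← of_injective hb] at h
      rw [eq_of_mem_zero (mem_comm h)]
    · rintro rfl
      exact ⟨t, zero, rfl, rfl, mem_comm (mem_zero t)⟩
  add_comm x y := ext_of fun t => by
    simp only [add_eq_of_iff]
    exact ⟨fun ⟨a, b, ha, hb, h⟩ => ⟨b, a, hb, ha, mem_comm h⟩,
      fun ⟨a, b, ha, hb, h⟩ => ⟨b, a, hb, ha, mem_comm h⟩⟩

theorem of_zero : of (zero : A) = 0 := rfl

theorem of_add_of_eq_of_iff {a b c : A} : of a + of b = of c ↔ c ∈ oplus a b := by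
  rw [add_eq_of_iff]
  constructor
  · rintro ⟨a', b', ha, hb, h⟩
    rwa [of_injective ha, of_injective hb]
  · exact fun h => ⟨a, b, rfl, rfl, h⟩

/-- Maps that preserve `0` and `⊕` preserve finite sums. -/
theorem sum_of_map {B : Type v} [EffectAlgebra B] {ι : Type w} {g : A → B}
    (g0 : g zero = zero) (hg : ∀ a b c, c ∈ oplus a b → g c ∈ oplus (g a) (g b))
    (s : Finset ι) (f : ι → A) {a : A} (h : ∑ i ∈ s, of (f i) = of a) :
    ∑ i ∈ s, of (g (f i)) = of (g a) := by
  classical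
  induction s using Finset.induction_on generalizing a with
  | empty =>
    rw [Finset.sum_empty, ← of_zero] at h ⊢
    rw [← of_injective h, g0]
  | insert i s hi ih =>
    rw [Finset.sum_insert hi] at h ⊢
    -- As the total is defined, the sum over `s` has some value `c`; the induction must therefore
    -- range over all values.
    obtain ⟨b, c, hb, hc, ha⟩ := add_eq_of_iff.1 h
    rw [ih hc, of_add_of_eq_of_iff]
    rw [← of_injective hb] at ha
    exact hg _ _ _ ha

end

end FormalSum

theorem pi_mem_iff {X : Type v} {A : Type u} [EffectAlgebra A] {f g h : X → A} :
    h ∈ oplus f g ↔ ∀ x, h x ∈ oplus (f x) (g x) := by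
  constructor
  · rintro ⟨hd, rfl⟩ x
    exact ⟨hd x, rfl⟩
  · intro H
    exact ⟨fun x => (H x).1, funext fun x => (H x).2⟩

theorem unitInterval_one : (one : unitInterval) = 1 := unitInterval.symm_zero

open FormalSum

/-! ### The effect modules `[0,1] ^ X` -/

section cube

variable {X : Type v} {E : Type u} [EffectModule E]

/-- Multiplication by a scalar in an effect module. -/
abbrev act (r : unitInterval) (e : E) : E := EffectModule.action.toFun r e

open EffectModule

theorem of_act_add (e : E) {r s t : unitInterval} (h : t ∈ oplus r s) :
    of (act r e) + of (act s e) = of (act t e) :=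
  of_add_of_eq_of_iff.2 (action.oplus_left _ _ _ e h)

theorem of_act_compl (e : E) (r : unitInterval) :
    of (act r e) + of (act (compl r) e) = of e := by
  rw [of_act_add e (one_mem r), unitInterval_one, act, one_action]

variable [Fintype X]

theorem sum_act_add (e : X → E) {r s t : X → unitInterval} (h : t ∈ oplus r s) :
    ∑ x, of (act (r x) (e x)) + ∑ x, of (act (s x) (e x)) = ∑ x, of (act (t x) (e x)) := by
  rw [← Finset.sum_add_distrib]
  exact Finset.sum_congr rfl fun x _ => of_act_add (e x) (pi_mem_iff.1 h x)

theorem sum_act_compl (e : X → E) (r : X → unitInterval) :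
    ∑ x, of (act (r x) (e x)) + ∑ x, of (act (compl r x) (e x)) = ∑ x, of (e x) := by
  rw [← Finset.sum_add_distrib]
  exact Finset.sum_congr rfl fun x _ => of_act_compl (e x) (r x)

variable (e : X → E)

/-- Adding the same sum with weights `rᗮ` gives `⨁ e x = 1`, and a summand of a defined sum is
defined. -/
theorem exists_sum_act (he : ∑ x, of (e x) = of one) (r : X → unitInterval) : ∃ a, ∑ x, of (act (r x) (e x)) = of a := by
  obtain ⟨a, _, ha, -⟩ := add_eq_of_iff.1 ((sum_act_compl e r).trans he)
  exact ⟨a, ha⟩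

/-- The morphism `[0,1] ^ X → E`, `r ↦ ⨁ r x • e x`, for a family `e` with sum `1`. -/
noncomputable def cubeLift (he : ∑ x, of (e x) = of one) :
    EffectModuleHom (X → unitInterval) E where
  toFun r := (exists_sum_act e he r).choose
  map_zero := of_injective <| by
    rw [← (exists_sum_act e he zero).choose_spec]
    exact Finset.sum_eq_zero fun x _ => congrArg of (action.zero_left (e x))
  -- The weights `r` and `rᗮ` contribute sums adding up to `⨁ e x = 1`, and the complement is
  -- unique.
  map_compl r := one_mem_iff.1 <| of_add_of_eq_of_iff.1 <| by
    rw [← (exists_sum_act e he r).choose_spec, ← (exists_sum_act e he (compl r)).choose_spec,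
      sum_act_compl, he]
  map_oplus r s t h := of_add_of_eq_of_iff.1 <| by
    rw [← (exists_sum_act e he r).choose_spec, ← (exists_sum_act e he s).choose_spec,
      ← (exists_sum_act e he t).choose_spec, sum_act_add e h]
  -- Acting by `r` preserves `0` and `⊕`, so it passes through the sum; associativity of the action
  -- then compares the terms.
  map_action r s := of_injective <| by
    rw [← (exists_sum_act e he _).choose_spec,
      ← sum_of_map (action.zero_right r) (action.oplus_right r) _ _
        (exists_sum_act e he s).choose_spec]
    exact Finset.sum_congr rfl fun x _ => congrArg of (mul_action r (s x) (e x))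

theorem of_cubeLift (he : ∑ x, of (e x) = of one) (r : X → unitInterval) :
    of ((cubeLift e he).toFun r) = ∑ x, of (act (r x) (e x)) :=
  (exists_sum_act e he r).choose_spec.symm

-- The scalars `1` and `0` keep and kill a term, so `χ_S` selects the subsum over `S`. This is the
-- same expression as in `of_hom_set`, which is what identifies the two morphisms on all of `2 ^ X`.
open Classical in
theorem of_cubeLift_indicator (he : ∑ x, of (e x) = of one) (S : Set X) :
    of ((cubeLift e he).toFun (S.indicator fun _ => 1)) = ∑ x, if x ∈ S then of (e x) else 0 := by
  rw [of_cubeLift]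
  refine Finset.sum_congr rfl fun x _ => ?_
  by_cases hx : x ∈ S
  · rw [Set.indicator_of_mem hx, if_pos hx, act, one_action]
  · rw [Set.indicator_of_notMem hx, if_neg hx]
    exact congrArg of (action.zero_left (e x))

theorem cubeLift_indicator_singleton (he : ∑ x, of (e x) = of one) (x : X) :
    (cubeLift e he).toFun (({x} : Set X).indicator fun _ => 1) = e x := by
  classical
  refine of_injective ?_
  rw [of_cubeLift_indicator]
  simp

theorem sum_unitInterval_ite [DecidableEq X] (r : unitInterval) (y : X) :
    ∑ x, of (if x = y then r else 0) = of r := by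
  rw [Finset.sum_eq_single y]
  · simp
  · intro x _ hx
    rw [if_neg hx]
    rfl
  · simp

end cube

/-- Finite sums in powers are computed pointwise. -/
theorem FormalSum.sum_of_pi {X : Type v} {A : Type u} [EffectAlgebra A] {ι : Type w}
    (s : Finset ι) (f : ι → X → A) {g : X → A} (h : ∀ y, ∑ i ∈ s, of (f i y) = of (g y)) :
    ∑ i ∈ s, of (f i) = of g := by
  classical
  induction s using Finset.induction_on generalizing g with
  | empty =>
    refine congrArg of (funext fun y => of_injective ?_)
    rw [← h y, Finset.sum_empty]
    rfl
  | insert i s hi ih =>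
    simp only [Finset.sum_insert hi, add_eq_of_iff] at h ⊢
    -- At each point the sum over `s` has a value `b y`; these values form the function to which the
    -- induction hypothesis applies.
    choose a b ha hb hab using h
    refine ⟨f i, b, rfl, ih hb, pi_mem_iff.2 fun y => ?_⟩
    rw [of_injective (ha y)]
    exact hab y

/-! ### Morphisms out of `2 ^ X` and the comparison of `[0,1] ⊗ 2 ^ X` with the cube -/

section powerset

/-- The power set of `X` as an effect algebra. -/
@[reducible] instance instPowerset (X : Type u) : EffectAlgebra (Set X) :=
  ofBooleanAlgebra (Set X)

variable {X : Type u}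

/-- The characteristic function `2 ^ X → [0,1] ^ X`. -/
noncomputable def indicatorHom (X : Type u) :
    Hom (Set X) (X → unitInterval) :=
  { toFun := fun S => S.indicator fun _ => 1
    map_zero := Set.indicator_empty _
    map_compl := fun S => funext fun x => by
      change Sᶜ.indicator (fun _ => (1 : unitInterval)) x =
        unitInterval.symm (S.indicator (fun _ => (1 : unitInterval)) x)
      by_cases h : x ∈ S <;> simp [h]
    map_oplus := by
      rintro S T _ ⟨h, rfl⟩
      have h' : S ∩ T = ∅ := h
      refine pi_mem_iff.2 fun x => ?_
      change (S ∪ T).indicator _ x ∈ _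
      by_cases hS : x ∈ S
      · have hT : x ∉ T := fun hT => (h' ▸ (⟨hS, hT⟩ : x ∈ S ∩ T) : x ∈ (∅ : Set X))
        rw [Set.indicator_of_mem hS, Set.indicator_of_notMem hT,
          Set.indicator_of_mem (Set.mem_union_left T hS)]
        exact mem_comm (mem_zero _)
      · rw [Set.indicator_of_notMem hS]
        by_cases hT : x ∈ T
        · rw [Set.indicator_of_mem hT, Set.indicator_of_mem (Set.mem_union_right S hT)]
          exact mem_zero _
        · rw [Set.indicator_of_notMem hT, Set.indicator_of_notMem (by simp [hS, hT])]
          exact mem_zero _ }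

/-- The effect module `[0,1] ⊗ 2 ^ X`. -/
abbrev TensorPowerset (X : Type u) : Type u :=
  Tensor unitInterval (Set X)

/-- The morphism `S ↦ 1 ⊗ S`. -/
noncomputable def unitPowerset (X : Type u) :
    Hom (Set X) (TensorPowerset X) :=
  FreeEffectModule.unit (Set X)

/-- The morphism `[0,1] ⊗ 2 ^ X → [0,1] ^ X`, `r ⊗ S ↦ r • χ_S`. -/
noncomputable def toCube (X : Type u) :
    EffectModuleHom (TensorPowerset X) (X → unitInterval) :=
  FreeEffectModule.lift (indicatorHom X)

theorem toCube_unit (S : Set X) :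
    (toCube X).toFun ((unitPowerset X).toFun S) = S.indicator fun _ => 1 :=
  FreeEffectModule.lift_unit (indicatorHom X) S

variable [Fintype X]

open Classical in
/-- A morphism out of `2 ^ X` is determined by its values on singletons. -/
theorem of_hom_set {A : Type v} [EffectAlgebra A]
    (f : Hom (Set X) A) (S : Set X) :
    of (f.toFun S) = ∑ x, if x ∈ S then of (f.toFun {x}) else 0 := by
  -- Each finite set is a disjoint union of singletons, and `⊕` in `2 ^ X` is disjoint union.
  have key : ∀ s : Finset X, of (f.toFun (s : Set X)) = ∑ x ∈ s, of (f.toFun {x}) := by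
    intro s
    induction s using Finset.induction_on with
    | empty =>
      rw [Finset.sum_empty, Finset.coe_empty]
      exact congrArg of f.map_zero
    | insert x s hx ih =>
      rw [Finset.sum_insert hx, ← ih, eq_comm, of_add_of_eq_of_iff]
      refine f.map_oplus _ _ _ ⟨?_, ?_⟩
      · change ({x} : Set X) ∩ ↑s = ∅
        simpa using hx
      · change ({x} : Set X) ∪ ↑s = _
        simp
  rw [← Finset.sum_filter, ← key]
  simp

/-- The whole set is the sum of its atoms, and `f` preserves `1`. This supplies the partition of
unity that `cubeLift` requires. -/
theorem sum_of_hom_singleton {A : Type v} [EffectAlgebra A]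
    (f : Hom (Set X) A) :
    ∑ x, of (f.toFun {x}) = of one := by
  have h1 : (one : Set X) = Set.univ := compl_bot
  rw [← f.map_one, h1, of_hom_set]
  simp

/-- At the point `y` only the atom `{y}` contributes, with weight `r y`. -/
theorem sum_act_indicator (r : X → unitInterval) :
    ∑ x, of (act (r x) ((indicatorHom X).toFun {x})) = of r := by
  classical
  refine sum_of_pi _ _ fun y => ?_
  rw [← sum_unitInterval_ite (r y) y]
  refine Finset.sum_congr rfl fun x _ => congrArg of ?_
  change r x * ({x} : Set X).indicator (fun _ => (1 : unitInterval)) y = _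
  by_cases h : x = y
  · subst h
    simp
  · simp [h, Ne.symm h]

/-- Every `r` is the sum of the `r x • χ_{x}`, and morphisms preserve scalars and finite sums. -/
theorem cube_hom_ext {E : Type v} [EffectModule E] {f g : EffectModuleHom (X → unitInterval) E}
    (h : ∀ x, f.toFun ((indicatorHom X).toFun {x}) = g.toFun ((indicatorHom X).toFun {x})) :
    f = g := by
  refine EffectModuleHom.ext (funext fun r => of_injective ?_)
  rw [← sum_of_map f.map_zero f.map_oplus _ _ (sum_act_indicator r),
    ← sum_of_map g.map_zero g.map_oplus _ _ (sum_act_indicator r)]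
  refine Finset.sum_congr rfl fun x _ => congrArg of ?_
  rw [f.map_action, g.map_action, h]

/-- The inverse `[0,1] ^ X → [0,1] ⊗ 2 ^ X` of `toCube`. -/
noncomputable def ofCube (X : Type u) [Fintype X] :
    EffectModuleHom (X → unitInterval) (TensorPowerset X) :=
  cubeLift (fun x => (unitPowerset X).toFun {x}) (sum_of_hom_singleton _)

theorem ofCube_comp_toCube (r : X → unitInterval) : (toCube X).toFun ((ofCube X).toFun r) = r := by
  have : (ofCube X).comp (toCube X) = ⟨⟨fun r => r, rfl, fun _ => rfl, fun _ _ _ h => h⟩,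
      fun _ _ => rfl⟩ := by
    refine cube_hom_ext fun x => ?_
    change (toCube X).toFun ((cubeLift _ _).toFun _) = _
    rw [indicatorHom, cubeLift_indicator_singleton, toCube_unit]
  exact congrArg (fun f => f.toFun r) this

theorem toCube_comp_ofCube (t : TensorPowerset X) :
    (ofCube X).toFun ((toCube X).toFun t) = t := by
  have : (toCube X).comp (ofCube X) = ⟨⟨fun r => r, rfl, fun _ => rfl, fun _ _ _ h => h⟩,
      fun _ _ => rfl⟩ := by
    refine FreeEffectModule.hom_ext fun S => of_injective ?_
    change of ((ofCube X).toFun ((toCube X).toFun ((unitPowerset X).toFun S))) =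
      of ((unitPowerset X).toFun S)
    -- Both sides are the sum over `x ∈ S` of the elements `1 ⊗ {x}`.
    rw [toCube_unit, ofCube, of_cubeLift_indicator, of_hom_set]
  exact congrArg (fun f => f.toFun t) this

theorem tensorPowerset_hom_ext {E : Type u} [EffectModule E]
    {f g : EffectModuleHom (TensorPowerset X) E}
    (h : ∀ x, f.toFun ((unitPowerset X).toFun {x}) = g.toFun ((unitPowerset X).toFun {x})) :
    f = g := by
  classical
  refine FreeEffectModule.hom_ext fun S => of_injective ?_
  have := of_hom_set ((unitPowerset X).comp f.toHom) S
  have h' := of_hom_set ((unitPowerset X).comp g.toHom) S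
  refine this.trans (Eq.trans ?_ h'.symm)
  refine Finset.sum_congr rfl fun x _ => ?_
  congr 2
  exact h x

end powerset

/-! ### Sums `d = a ⊕ b` as morphisms out of `[0,1] ⊗ 2 ^ 3` -/

section triple

variable {E : Type u} [EffectModule E]

/-- A set with three elements. -/
abbrev Three : Type u := Option (Option PUnit.{u + 1})

/-- The family `(a, b, c)`, indexed by `Three`. -/
def tripleFamily (a b c : E) : Three.{u} → E
  | none => a
  | some none => b
  | some (some _) => c

theorem sum_tripleFamily {a b d : E} (h : d ∈ oplus a b) :
    ∑ x, of (tripleFamily a b (compl d) x) = of one := by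
  rw [Fintype.sum_option, Fintype.sum_option, ← add_assoc]
  simp only [Finset.univ_unique, Finset.sum_singleton]
  change of a + of b + of (compl d) = of one
  rw [of_add_of_eq_of_iff.2 h, of_add_of_eq_of_iff.2 (one_mem d)]

/-- For `d = a ⊕ b` in an effect module `E`, the morphism `[0,1] ⊗ 2 ^ 3 → E` that sends the three
atoms to `a`, `b` and `dᗮ`. -/
noncomputable def triple {a b d : E} (h : d ∈ oplus a b) :
    EffectModuleHom (TensorPowerset Three.{u}) E :=
  (toCube _).comp (cubeLift _ (sum_tripleFamily h))

theorem triple_singleton {a b d : E} (h : d ∈ oplus a b) (x : Three.{u}) :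
    (triple h).toFun ((unitPowerset _).toFun {x}) = tripleFamily a b (compl d) x := by
  change (cubeLift _ (sum_tripleFamily h)).toFun ((toCube _).toFun _) = _
  rw [toCube_unit, cubeLift_indicator_singleton]

theorem tripleFamily_map {F : Type u} [EffectModule F] (f : EffectModuleHom E F) (a b c : E)
    (x : Three.{u}) :
    f.toFun (tripleFamily a b c x) = tripleFamily (f.toFun a) (f.toFun b) (f.toFun c) x := by
  rcases x with _ | _ | _ <;> rfl

/-- Naturality: `f` carries the partition `(a, b, dᗮ)` to the one of the image sum. It provides the
commuting triangles in the canonical diagram. -/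
theorem triple_comp {F : Type u} [EffectModule F] (f : EffectModuleHom E F) {a b d : E}
    (h : d ∈ oplus a b) : (triple h).comp f = triple (f.map_oplus _ _ _ h) := by
  refine tensorPowerset_hom_ext fun x => ?_
  change f.toFun ((triple h).toFun _) = _
  rw [triple_singleton, triple_singleton, tripleFamily_map, f.map_compl]

end triple

end EffectAlgebra

/-! ### The comparison functor -/

section comparison

variable {C : Type*} {D : Type*} [Category C] [Category D] {L : C ⥤ D} {R : D ⥤ C} (adj : L ⊣ R)

/-- Being a transpose, the action on morphisms is a bijection of hom-sets, whence fullness and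
faithfulness. -/
theorem kleisliComparison_map {X Y : Kleisli adj.toMonad} (f : X ⟶ Y) :
    (kleisliComparison adj).map f = (adj.homEquiv X.of (L.obj Y.of)).symm f.of :=
  (adj.homEquiv_counit _ _ _).symm

instance : (kleisliComparison adj).Faithful where
  map_injective {X Y f g} h := by
    rw [kleisliComparison_map, kleisliComparison_map] at h
    exact Kleisli.hom_ext ((adj.homEquiv X.of (L.obj Y.of)).symm.injective h)

instance : (kleisliComparison adj).Full where
  map_surjective {X Y} g := by
    refine ⟨.mk (adj.homEquiv X.of (L.obj Y.of) g), ?_⟩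
    rw [kleisliComparison_map]
    exact Equiv.symm_apply_apply _ _

end comparison

instance : inclusionM.{u}.Full :=
  inferInstanceAs (inducedFunctor FinBoolAlg.toKleisli ⋙ kleisliComparison freeForgetAdj).Full

instance : inclusionM.{u}.Faithful :=
  inferInstanceAs (inducedFunctor FinBoolAlg.toKleisli ⋙ kleisliComparison freeForgetAdj).Faithful

/-- The isomorphism `[0,1] ⊗ 2 ^ X ≅ [0,1] ^ X`. -/
noncomputable def cubeIso (X : Type u) [Fintype X] :
    inclusionM.obj (powersetAlg X) ≅ cubeEMod X where
  hom := toCube X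
  inv := ofCube X
  hom_inv_id := EffectModuleHom.ext (funext toCube_comp_ofCube)
  inv_hom_id := EffectModuleHom.ext (funext ofCube_comp_toCube)

/-! ### Density -/

section dense

variable {E : EMod.{u}}

/-- The object of the canonical diagram of `E` given by `d = a ⊕ b` in `E`. -/
noncomputable def tripleArrow {a b d : E.carrier} (h : d ∈ oplus a b) :
    CostructuredArrow inclusionM.{u} E :=
  CostructuredArrow.mk (Y := powersetAlg Three.{u}) (S := inclusionM)
    (show inclusionM.obj (powersetAlg Three.{u}) ⟶ E from triple h)

variable (s : Limits.Cocone (CostructuredArrow.proj inclusionM.{u} E ⋙ inclusionM))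

/-- The morphism in a cocone at an object of the canonical diagram. -/
def coconeHom (j : CostructuredArrow inclusionM.{u} E) :
    EffectModuleHom (inclusionM.obj j.left).carrier s.pt.carrier :=
  s.ι.app j

/-- The map `E → Z` induced by a cocone with vertex `Z` on the canonical diagram of `E`. -/
noncomputable def coconeDesc (e : E.carrier) : s.pt.carrier :=
  (coconeHom s (tripleArrow (mem_zero e))).toFun ((unitPowerset Three.{u}).toFun {some none})

/-- The triple of `x = 0 ⊕ x` already lives in the source of `j.hom`, and `j.hom` carries it to the
triple of its image. It is thus an arrow of the canonical diagram, and compatibility of the cocone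
along it gives the equation. -/
theorem coconeDesc_hom (j : CostructuredArrow inclusionM.{u} E)
    (x : (inclusionM.obj j.left).carrier) :
    coconeDesc s ((EffectModuleHom.toHom j.hom).toFun x) = (coconeHom s j).toFun x := by
  -- `j.hom` sends `0` to `0` only propositionally, while the arrow used by `coconeDesc` is built on
  -- `zero` itself; hence `z` is a variable, eliminated by `hz`.
  have key : ∀ (z : E.carrier) (hz : z = zero) (y : E.carrier) (h : y ∈ oplus z y)
      (t : inclusionM.obj (powersetAlg Three.{u}) ⟶ inclusionM.obj j.left)
      (ht : t ≫ j.hom = triple h),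
      coconeDesc s y = (coconeHom s j).toFun
        ((EffectModuleHom.toHom t).toFun ((unitPowerset Three.{u}).toFun {some none})) := by
    rintro z rfl y h t ht
    -- Fullness turns the effect module morphism `t` into a Kleisli morphism, as the diagram
    -- demands.
    have e : inclusionM.map (inclusionM.preimage t) ≫ j.hom = (tripleArrow h).hom := by
      rw [Functor.map_preimage]
      exact ht
    have w := s.w (CostructuredArrow.homMk (inclusionM.preimage t) e : tripleArrow h ⟶ j)
    have w' : t ≫ s.ι.app j = s.ι.app (tripleArrow h) := by
      rw [← w]
      change _ = inclusionM.map (inclusionM.preimage t) ≫ _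
      rw [Functor.map_preimage]
    exact (congrArg (fun f => (EffectModuleHom.toHom f).toFun
      ((unitPowerset Three.{u}).toFun {some none})) w').symm
  rw [key _ (Hom.map_zero (EffectModuleHom.toHom j.hom)) _
    ((EffectModuleHom.toHom j.hom).map_oplus _ _ _ (mem_zero x)) (triple (mem_zero x))
    (triple_comp _ _), triple_singleton]
  rfl

/-- The atoms `none` and `some none` of `2 ^ 3` are disjoint, and `triple h` sends them to `a` and
`b`, hence their union to `d`. Having the whole sum in one object is what makes the descent map
additive. -/
theorem exists_arrow {a b d : E.carrier} (h : d ∈ oplus a b) :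
    ∃ (j : CostructuredArrow inclusionM.{u} E) (x y z : (inclusionM.obj j.left).carrier),
      z ∈ oplus x y ∧ (EffectModuleHom.toHom j.hom).toFun x = a ∧ (EffectModuleHom.toHom j.hom).toFun y = b ∧
        (EffectModuleHom.toHom j.hom).toFun z = d := by
  have hm : ({none} ∪ {some none} : Set Three.{u}) ∈
      oplus ({none} : Set Three.{u}) {some none} := by
    refine ⟨?_, rfl⟩
    change ({none} ∩ {some none} : Set Three.{u}) = ∅
    simp
  have hz := (unitPowerset Three.{u}).map_oplus _ _ _ hm
  have hx := triple_singleton h none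
  have hy := triple_singleton h (some none)
  refine ⟨tripleArrow h, _, _, _, hz, hx, hy, ?_⟩
  have h' := (triple h).map_oplus _ _ _ hz
  rw [hx, hy] at h'
  exact Part.mem_unique h' h

theorem exists_arrow_apply (e : E.carrier) :
    ∃ (j : CostructuredArrow inclusionM.{u} E) (x : (inclusionM.obj j.left).carrier),
      (EffectModuleHom.toHom j.hom).toFun x = e := by
  obtain ⟨j, _, y, _, -, -, hy, -⟩ := exists_arrow (mem_zero e)
  exact ⟨j, y, hy⟩

/-- The morphism `E ⟶ Z` induced by a cocone with vertex `Z` on the canonical diagram of `E`. -/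
noncomputable def coconeDescHom : EffectModuleHom E.carrier s.pt.carrier where
  toFun := coconeDesc s
  map_zero := by
    obtain ⟨j, -⟩ := exists_arrow_apply (zero : E.carrier)
    rw [← (EffectModuleHom.toHom j.hom).map_zero, coconeDesc_hom, (coconeHom s j).map_zero]
  map_compl e := by
    obtain ⟨j, x, rfl⟩ := exists_arrow_apply e
    rw [← (EffectModuleHom.toHom j.hom).map_compl, coconeDesc_hom, coconeDesc_hom,
      (coconeHom s j).map_compl]
  map_oplus a b d h := by
    obtain ⟨j, x, y, z, hz, rfl, rfl, rfl⟩ := exists_arrow h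
    rw [coconeDesc_hom, coconeDesc_hom, coconeDesc_hom]
    exact (coconeHom s j).map_oplus _ _ _ hz
  map_action r e := by
    obtain ⟨j, x, rfl⟩ := exists_arrow_apply e
    rw [← EffectModuleHom.map_action j.hom, coconeDesc_hom, coconeDesc_hom,
      (coconeHom s j).map_action]

end dense

instance : inclusionM.{u}.IsDense where
  isDenseAt E := ⟨(Functor.denseAtEquiv _ E).symm
    { desc := fun s => coconeDescHom s
      fac := fun s j => EffectModuleHom.ext (funext fun x => coconeDesc_hom s j x)
      uniq := fun s m hm => EffectModuleHom.ext (funext fun e => by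
        -- Joint surjectivity: on `e = j.hom x` both morphisms equal the leg at `j` applied to `x`.
        obtain ⟨j, x, rfl⟩ := exists_arrow_apply e
        refine Eq.trans ?_ (coconeDesc_hom s j x).symm
        exact congrArg (fun f => (EffectModuleHom.toHom f).toFun x) (hm j)) }⟩

theorem proposition6p2 :
    inclusionM.{u}.IsDense ∧ inclusionM.{u}.Full ∧ inclusionM.{u}.Faithful ∧
      ∀ (X : Type u) [Fintype X],
        ∃ φ : inclusionM.obj (powersetAlg X) ≅ cubeEMod X,
          ∀ S : Set X, φ.hom.toFun (oneTensor X S) = S.indicator (fun _ => (1 : unitInterval)) :=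
  -- By definition `oneTensor X S` is the adjunction unit at `S`, so `toCube_unit` applies.
  ⟨inferInstance, inferInstance, inferInstance, fun X _ => ⟨cubeIso X, toCube_unit⟩⟩
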